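/- Let $c, g_1, g_2 \in \mathbb{R}$ with $c \neq 0$ and $g_2 \neq 0$, and consider the planar system $$\frac{d\varphi}{d\zeta} = \tfrac12(\varphi-c)^2 y, \qquad \frac{dy}{d\zeta} = (\varphi-c)\bigl(g_1-\tfrac12 y^2-\varphi^2\bigr)-2g_2\varphi. \tag{S}$$ Put $a = g_1-2g_2$, $b=-cg_1$, $f(\varphi) = -\varphi^3+c\varphi^2+a\varphi+b$, and assume $\Delta = 4c^2+12a>0$. Let $\varphi_1^* = \frac13\bigl(c-\sqrt{c^2+3a}\bigr) < \varphi_2^* = \frac13\bigl(c+\sqrt{c^2+3a}\bigr)$ be the two zeros of $f'$, and let $f_1=f(\varphi_1^*)$, $f_2=f(\varphi_2^*)$. Then: 1. If $f_2<0$, then (S) has exactly one equilibrium point $(\varphi_1,0)$; it satisfies $\varphi_1<\varphi_1^*<\varphi_2^*$ and is a center. 2. If $f_1>0$, then (S) has exactly one equilibrium point $(\varphi_2,0)$; it satisfies $\varphi_1^*<\varphi_2^*<\varphi_2$ and is a center. 3. If $f_1=0$, then (S) has exactly two equilibrium points $(\varphi_3,0)$ and $(\varphi_4,0)$, with $\varphi_3=\varphi_1^*<\varphi_2^*<\varphi_4$;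 $(\varphi_3,0)$ is a cusp and $(\varphi_4,0)$ is a center. 4. If $f_2=0$, then (S) has exactly two equilibrium points $(\varphi_5,0)$ and $(\varphi_6,0)$, with $\varphi_5<\varphi_1^*<\varphi_2^*=\varphi_6$; $(\varphi_5,0)$ is a center and $(\varphi_6,0)$ is a cusp. 5. If $f_1<0<f_2$, then (S) has exactly three equilibrium points $(\varphi_7,0)$, $(\varphi_8,0)$, $(\varphi_9,0)$, with $\varphi_7<\varphi_1^*<\varphi_8<\varphi_2^*<\varphi_9$; $(\varphi_7,0)$ and $(\varphi_9,0)$ are centers and $(\varphi_8,0)$ is a saddle. Here an equilibrium $p$ is a *center* if for every neighbourhood $W$ of $p$ there is a neighbourhood $U$ of $p$ such that every point of $U\setminus\{p\}$ lies on a closed orbit contained in $W$ with $p$ in its interior. It is a *saddle* if the linearization at $p$ has one negative and one positive eigenvalue and the phase portrait near $p$ is topologically equivalent (by a local homeomorphism mapping orbits to orbits and preserving their direction) to that of $x'=y$, $y'=x$ at the origin. It is a *cusp* if the linearization at $p$ has determinant $0$, the Poincaré index of $p$ is $0$, and the phase portrait near $p$ is topologically equivalent in the same sense to that of $x'=y$,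 $y'=x^2$ at the origin (two hyperbolic sectors and two separatrices). -/

import Mathlib

open Set Filter Topology

noncomputable section

namespace KaupBoussinesq

/-- The regularised planar system
`dφ/dζ = (1/2)(φ - c)² y`, `dy/dζ = (φ - c)(g₁ - y²/2 - φ²) - 2 g₂ φ`,
as a vector field on the plane of points `(φ, y)`. -/
def field (c g₁ g₂ : ℝ) (q : ℝ × ℝ) : ℝ × ℝ :=
  (1 / 2 * (q.1 - c) ^ 2 * q.2,
    (q.1 - c) * (g₁ - 1 / 2 * q.2 ^ 2 - q.1 ^ 2) - 2 * g₂ * q.1)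

/-- The set of equilibrium points of a planar vector field. -/
def equilibria (X : ℝ × ℝ → ℝ × ℝ) : Set (ℝ × ℝ) := {q | X q = 0}

/-- The coefficient `a = g₁ - 2 g₂`. -/
def coeffA (g₁ g₂ : ℝ) : ℝ := g₁ - 2 * g₂

/-- The coefficient `b = -c g₁`. -/
def coeffB (c g₁ : ℝ) : ℝ := -c * g₁

/-- The cubic `f(φ) = -φ³ + c φ² + a φ + b`. -/
def cubic (c g₁ g₂ φ : ℝ) : ℝ :=
  -φ ^ 3 + c * φ ^ 2 + coeffA g₁ g₂ * φ + coeffB c g₁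

/-- The smaller critical point `φ₁* = (c - √(c² + 3a)) / 3` of the cubic. -/
def phiStar₁ (c g₁ g₂ : ℝ) : ℝ := 1 / 3 * (c - √(c ^ 2 + 3 * coeffA g₁ g₂))

/-- The larger critical point `φ₂* = (c + √(c² + 3a)) / 3` of the cubic. -/
def phiStar₂ (c g₁ g₂ : ℝ) : ℝ := 1 / 3 * (c + √(c ^ 2 + 3 * coeffA g₁ g₂))

/-- The point `p` lies in the interior of the closed curve with image `S`: it is off the curve, and
its connected component in the complement of the curve is bounded. -/
def Encloses (S : Set (ℝ × ℝ)) (p : ℝ × ℝ) : Prop :=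
  p ∉ S ∧ Bornology.IsBounded (connectedComponentIn Sᶜ p)

/-- An equilibrium `p` is a center: it has arbitrarily small neighbourhoods in which every other
point lies on a closed orbit that stays close to `p` and has `p` in its interior. -/
def IsCenter (X : ℝ × ℝ → ℝ × ℝ) (p : ℝ × ℝ) : Prop :=
  X p = 0 ∧
    ∀ W ∈ 𝓝 p, ∃ U ∈ 𝓝 p, ∀ q ∈ U, q ≠ p →
      ∃ (γ : ℝ → ℝ × ℝ) (T : ℝ), γ 0 = q ∧ (∀ t, HasDerivAt γ (X (γ t)) t) ∧
        0 < T ∧ Function.Periodic γ T ∧ range γ ⊆ W ∧ Encloses (range γ) p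

/-- `h` carries every arc of an orbit of `X` inside `U` to an arc of an orbit of `Y`, with the same
direction of motion: after an increasing continuous change `τ` of the time, the image
is a solution of `Y`. -/
def MapsOrbits (X Y : ℝ × ℝ → ℝ × ℝ) (h : ℝ × ℝ → ℝ × ℝ) (U : Set (ℝ × ℝ)) : Prop :=
  ∀ (I : Set ℝ) (γ : ℝ → ℝ × ℝ), IsOpen I → I.OrdConnected →
    (∀ t ∈ I, HasDerivAt γ (X (γ t)) t) → MapsTo γ I U →
      ∃ (τ : ℝ → ℝ) (δ : ℝ → ℝ × ℝ), StrictMonoOn τ I ∧ ContinuousOn τ I ∧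
        (∀ s ∈ τ '' I, HasDerivAt δ (Y (δ s)) s) ∧ ∀ t ∈ I, δ (τ t) = h (γ t)

/-- The phase portraits of `X` near `p` and of `Y` near `q` are topologically equivalent: a
homeomorphism between neighbourhoods of `p` and `q` maps `p` to `q` and oriented orbits to
oriented orbits, in both directions. -/
def LocallyEquivalent (X : ℝ × ℝ → ℝ × ℝ) (p : ℝ × ℝ) (Y : ℝ × ℝ → ℝ × ℝ) (q : ℝ × ℝ) : Prop :=
  ∃ h : OpenPartialHomeomorph (ℝ × ℝ) (ℝ × ℝ), p ∈ h.source ∧ h p = q ∧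
    MapsOrbits X Y h h.source ∧ MapsOrbits Y X h.symm h.target

/-- An equilibrium `p` is a saddle: the linearization has a negative and a positive
eigenvalue, and the phase portrait near `p` is that of the linear saddle `x' = y`, `y' = x`. -/
def IsSaddle (X : ℝ × ℝ → ℝ × ℝ) (p : ℝ × ℝ) : Prop :=
  X p = 0 ∧
    (∃ l m : ℝ, l < 0 ∧ 0 < m ∧
      Module.End.HasEigenvalue (fderiv ℝ X p : ℝ × ℝ →ₗ[ℝ] ℝ × ℝ) l ∧
      Module.End.HasEigenvalue (fderiv ℝ X p : ℝ × ℝ →ₗ[ℝ] ℝ × ℝ) m) ∧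
    LocallyEquivalent X p (fun z => (z.2, z.1)) 0

/-- The isolated equilibrium `p` has Poincaré index `n`: on every small circle around `p` the field
does not vanish, and its direction angle `θ`, chosen continuously, increases by `2πn` along one
counterclockwise turn. -/
def HasPoincareIndex (X : ℝ × ℝ → ℝ × ℝ) (p : ℝ × ℝ) (n : ℤ) : Prop :=
  ∃ r₀ : ℝ, 0 < r₀ ∧ ∀ r : ℝ, 0 < r → r < r₀ →
    ∃ ρ θ : ℝ → ℝ, Continuous θ ∧ (∀ t, 0 < ρ t) ∧
      (∀ t, X (p + (r * Real.cos t, r * Real.sin t)) =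
        (ρ t * Real.cos (θ t), ρ t * Real.sin (θ t))) ∧
      θ (2 * Real.pi) - θ 0 = 2 * Real.pi * n

/-- An equilibrium `p` is a cusp: the linearization is degenerate, the Poincaré index is `0`, and
the phase portrait near `p` is that of the standard cusp `x' = y`, `y' = x²` (two
hyperbolic sectors and two separatrices). -/
def IsCusp (X : ℝ × ℝ → ℝ × ℝ) (p : ℝ × ℝ) : Prop :=
  X p = 0 ∧ (fderiv ℝ X p).det = 0 ∧ HasPoincareIndex X p 0 ∧
    LocallyEquivalent X p (fun z => (z.2, z.1 ^ 2)) 0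

end KaupBoussinesq

end

/-! The second equation reads `y' = f(φ) - (φ - c) y² / 2`, and `f(c) = -2 c g₂ ≠ 0`, so equilibria
are the points `(φ₀, 0)` with `f(φ₀) = 0`, and all of them avoid the singular line `φ = c`.

Off that line put `Y = η (φ - c) y` with `η = ±1`. The terms in `y²` cancel: `φ' = η (φ - c) Y / 2`
and `Y' = η (φ - c) f(φ)`. If `x = ψ(φ)` with `ψ' N(ψ) = 2 f`, the field becomes `m • (Y, N(x))`
with `m = η (φ - c) ψ' / 2`, and `η` is chosen to make `m > 0`. Hence the orbits, with their
direction, are those of `x' = Y`, `Y' = N(x)` (`exists_isOrbitalDiffeo`). Integrating the condition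
on `ψ` reduces it to extracting a root of a primitive of `f`: `N(x) = -x` (center) where `f' < 0`,
`N(x) = x` (saddle) where `f' > 0`, `N(x) = x²` (cusp) at a double root.

Closed orbits of a center are circles carried back by the local diffeomorphism
(`IsOrbitalDiffeo.isCenter`). The index of a cusp is zero because the field omits a direction on
small circles (`hasPoincareIndex_zero`). Counting the roots of `f` and finding the signs of `f'`
there uses `f' = -3 (φ - s₁) (φ - s₂)`. -/

namespace KaupBoussinesq

/-! ### Time changes and orbital equivalence. -/

/-- On an open interval, the primitive of a positive continuous function has a differentiable
inverse. -/
theorem exists_inverse_of_primitive {I : Set ℝ} (hI : IsOpen I) (hIc : I.OrdConnected) {g : ℝ → ℝ}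
    (hg : ContinuousOn g I) (hpos : ∀ t ∈ I, 0 < g t) {t₀ : ℝ} (ht₀ : t₀ ∈ I) {τ : ℝ → ℝ}
    (hτ : τ = fun t => ∫ s in t₀..t, g s) :
    StrictMonoOn τ I ∧ ContinuousOn τ I ∧
      ∃ σ : ℝ → ℝ, ∀ t ∈ I, σ (τ t) = t ∧ HasDerivAt σ (g t)⁻¹ (τ t) := by
  have hd : ∀ t ∈ I, HasStrictDerivAt τ (g t) t := by
    intro t ht
    rw [hτ]
    exact intervalIntegral.integral_hasStrictDerivAt_right
      (hg.mono (hIc.uIcc_subset ht₀ ht)).intervalIntegrable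
      (hg.stronglyMeasurableAtFilter hI t ht) (hg.continuousAt (hI.mem_nhds ht))
  have hcont : ContinuousOn τ I := fun t ht => (hd t ht).hasDerivAt.continuousAt.continuousWithinAt
  have hmono : StrictMonoOn τ I := by
    refine strictMonoOn_of_deriv_pos hIc.convex hcont fun t ht => ?_
    rw [hI.interior_eq] at ht
    rw [(hd t ht).hasDerivAt.deriv]
    exact hpos t ht
  have hinv : ∀ t ∈ I, Function.invFunOn τ I (τ t) = t := hmono.injOn.leftInvOn_invFunOn
  have himg : Function.invFunOn τ I '' (τ '' I) = I := by
    rw [image_image]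
    exact (image_congr hinv).trans (image_id' I)
  refine ⟨hmono, hcont, Function.invFunOn τ I, fun t ht => ⟨hinv t ht, ?_⟩⟩
  have hmem : τ '' I ∈ 𝓝 (τ t) := by
    rw [← (hd t ht).map_nhds_eq (hpos t ht).ne']
    exact image_mem_map (hI.mem_nhds ht)
  have hσmono : StrictMonoOn (Function.invFunOn τ I) (τ '' I) := by
    rintro _ ⟨a, ha, rfl⟩ _ ⟨b, hb, rfl⟩ hab
    rw [hinv a ha, hinv b hb]
    exact (hmono.lt_iff_lt ha hb).1 hab
  refine HasDerivAt.of_local_left_inverse (f := τ) ?_ ?_ (hpos t ht).ne' ?_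
  -- A monotone function that maps a neighbourhood onto a neighbourhood is continuous.
  · refine hσmono.continuousAt_of_image_mem_nhds hmem ?_
    rw [himg, hinv t ht]
    exact hI.mem_nhds ht
  · rw [hinv t ht]
    exact (hd t ht).hasDerivAt
  · filter_upwards [hmem] with y hy
    obtain ⟨s, hs, rfl⟩ := hy
    rw [hinv s hs]

/-- Along `γ` the curve `h ∘ γ` has velocity `m • Y`; the new time `τ = ∫ m(γ)` divides the factor
`m` out. -/
theorem mapsOrbits_of_hasFDerivAt {X Y h : ℝ × ℝ → ℝ × ℝ} {U : Set (ℝ × ℝ)} {m : ℝ × ℝ → ℝ}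
    (hm : ContinuousOn m U) (hpos : ∀ z ∈ U, 0 < m z)
    (hd : ∀ z ∈ U, ∃ L : ℝ × ℝ →L[ℝ] ℝ × ℝ, HasFDerivAt h L z ∧ L (X z) = m z • Y (h z)) :
    MapsOrbits X Y h U := by
  intro I γ hI hIc hγ hU
  rcases I.eq_empty_or_nonempty with rfl | ⟨t₀, ht₀⟩
  · exact ⟨id, fun _ => 0, by simp [StrictMonoOn], by simp, by simp, by simp⟩
  have hγc : ContinuousOn γ I := fun t ht => (hγ t ht).continuousAt.continuousWithinAt
  obtain ⟨τ, hτ⟩ : ∃ τ : ℝ → ℝ, τ = fun t => ∫ s in t₀..t, m (γ s) := ⟨_, rfl⟩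
  obtain ⟨hmono, hcont, σ, hσ⟩ := exists_inverse_of_primitive hI hIc (hm.comp hγc hU)
    (fun t ht => hpos _ (hU ht)) ht₀ hτ
  refine ⟨τ, fun s => h (γ (σ s)), hmono, hcont, ?_, ?_⟩
  · rintro _ ⟨t, ht, rfl⟩
    obtain ⟨hσt, hσd⟩ := hσ t ht
    obtain ⟨L, hL, hLX⟩ := hd (γ t) (hU ht)
    have h₁ := HasDerivAt.scomp _ (by rw [hσt]; exact hγ t ht) hσd
    have h₂ := HasFDerivAt.comp_hasDerivAt _ (f := γ ∘ σ) (l := h) (l' := L)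
      (by simp only [Function.comp_apply]; rw [hσt]; exact hL) h₁
    have hne := (hpos _ (hU ht)).ne'
    simp only [Function.comp_apply, map_smul, hLX, smul_smul, inv_mul_cancel₀ hne, one_smul] at h₂
    beta_reduce
    rw [hσt]
    exact h₂
  · intro t ht
    simp only [(hσ t ht).1]

/-- `h` is differentiable with invertible derivatives, and carries the field `X` to the field `Y`
multiplied by the positive continuous function `m`. -/
structure IsOrbitalDiffeo (X Y : ℝ × ℝ → ℝ × ℝ) (h : OpenPartialHomeomorph (ℝ × ℝ) (ℝ × ℝ))
    (m : ℝ × ℝ → ℝ) : Prop where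
  continuousOn : ContinuousOn m h.source
  pos : ∀ z ∈ h.source, 0 < m z
  hasFDerivAt : ∀ z ∈ h.source, ∃ L : (ℝ × ℝ) ≃L[ℝ] (ℝ × ℝ),
    HasFDerivAt h (L : ℝ × ℝ →L[ℝ] ℝ × ℝ) z ∧ L (X z) = m z • Y (h z)

namespace IsOrbitalDiffeo

variable {X Y : ℝ × ℝ → ℝ × ℝ} {h : OpenPartialHomeomorph (ℝ × ℝ) (ℝ × ℝ)} {m : ℝ × ℝ → ℝ}

theorem symm (H : IsOrbitalDiffeo X Y h m) :
    IsOrbitalDiffeo Y X h.symm (fun z => (m (h.symm z))⁻¹) where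
  continuousOn := (H.continuousOn.comp h.continuousOn_symm h.mapsTo_symm).inv₀
    fun z hz => (H.pos _ (h.map_target hz)).ne'
  pos := fun z hz => inv_pos.2 (H.pos _ (h.map_target hz))
  hasFDerivAt := by
    intro z hz
    obtain ⟨L, hL, hLX⟩ := H.hasFDerivAt _ (h.map_target hz)
    refine ⟨L.symm, h.hasFDerivAt_symm hz hL, ?_⟩
    rw [h.right_inv hz] at hLX
    rw [ContinuousLinearEquiv.symm_apply_eq, map_smul, hLX, smul_smul,
      inv_mul_cancel₀ (H.pos _ (h.map_target hz)).ne', one_smul]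

theorem mapsOrbits (H : IsOrbitalDiffeo X Y h m) : MapsOrbits X Y h h.source :=
  mapsOrbits_of_hasFDerivAt H.continuousOn H.pos fun z hz =>
    let ⟨L, hL⟩ := H.hasFDerivAt z hz
    ⟨L, hL⟩

theorem locallyEquivalent (H : IsOrbitalDiffeo X Y h m) {p q : ℝ × ℝ} (hp : p ∈ h.source)
    (hpq : h p = q) : LocallyEquivalent X p Y q :=
  ⟨h, hp, hpq, H.mapsOrbits, H.symm.mapsOrbits⟩

end IsOrbitalDiffeo

/-! ### Rotations, closed orbits and centers. -/

theorem exists_cos_sin_eq {x y : ℝ} (hxy : x ^ 2 + y ^ 2 = 1) :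
    ∃ s, Real.cos s = x ∧ Real.sin s = y := by
  have hn : ‖(⟨x, y⟩ : ℂ)‖ = 1 := by
    rw [Complex.norm_eq_sqrt_sq_add_sq, hxy, Real.sqrt_one]
  have h0 : (⟨x, y⟩ : ℂ) ≠ 0 := norm_ne_zero_iff.1 (by rw [hn]; exact one_ne_zero)
  exact ⟨Complex.arg ⟨x, y⟩, by rw [Complex.cos_arg h0, hn, div_one],
    by rw [Complex.sin_arg, hn, div_one]⟩

/-- The clockwise rotation of the point `z` by the angle `s`. -/
noncomputable def rotation (z : ℝ × ℝ) (s : ℝ) : ℝ × ℝ :=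
  (z.1 * Real.cos s + z.2 * Real.sin s, z.2 * Real.cos s - z.1 * Real.sin s)

theorem rotation_sq (z : ℝ × ℝ) (s : ℝ) :
    (rotation z s).1 ^ 2 + (rotation z s).2 ^ 2 = z.1 ^ 2 + z.2 ^ 2 := by
  simp only [rotation]
  linear_combination (z.1 ^ 2 + z.2 ^ 2) * Real.sin_sq_add_cos_sq s

/-- In complex notation `rotation z s` is `z * exp (-i s)`, so `exp (i s) = z * conj q / |z|²` gives
the cosine and sine. -/
theorem exists_rotation_eq {z q : ℝ × ℝ} (hz : 0 < z.1 ^ 2 + z.2 ^ 2)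
    (hq : q.1 ^ 2 + q.2 ^ 2 = z.1 ^ 2 + z.2 ^ 2) : ∃ s, rotation z s = q := by
  obtain ⟨s, hc, hs⟩ := exists_cos_sin_eq
    (x := (q.1 * z.1 + q.2 * z.2) / (z.1 ^ 2 + z.2 ^ 2))
    (y := (q.1 * z.2 - q.2 * z.1) / (z.1 ^ 2 + z.2 ^ 2)) (by
      field_simp
      linear_combination (z.1 ^ 2 + z.2 ^ 2) * hq)
  refine ⟨s, Prod.ext ?_ ?_⟩
  · simp only [rotation, hc, hs]
    field_simp
    ring
  · simp only [rotation, hc, hs]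
    field_simp
    ring

theorem hasDerivAt_rotation (z : ℝ × ℝ) (s : ℝ) :
    HasDerivAt (rotation z) ((rotation z s).2, -(rotation z s).1) s := by
  refine HasDerivAt.prodMk ?_ ?_
  · convert! ((Real.hasDerivAt_cos s).const_mul z.1).add ((Real.hasDerivAt_sin s).const_mul z.2)
      using 1
    simp only [rotation]
    ring
  · convert! ((Real.hasDerivAt_cos s).const_mul z.2).sub ((Real.hasDerivAt_sin s).const_mul z.1)
      using 1
    simp only [rotation]
    ring

theorem rotation_zero (z : ℝ × ℝ) : rotation z 0 = z := by simp [rotation]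

theorem rotation_periodic (z : ℝ × ℝ) : Function.Periodic (rotation z) (2 * Real.pi) := by
  intro s
  simp [rotation]

theorem exists_disk_subset {A : Set (ℝ × ℝ)} (hA : A ∈ 𝓝 (0 : ℝ × ℝ)) :
    ∃ R : ℝ, 0 < R ∧ {z : ℝ × ℝ | z.1 ^ 2 + z.2 ^ 2 < R} ⊆ A := by
  obtain ⟨ε, hε, hA⟩ := Metric.mem_nhds_iff.1 hA
  refine ⟨ε ^ 2, by positivity, fun z hz => hA ?_⟩
  simp only [mem_ofPred_eq] at hz
  rw [mem_ball_zero_iff, Prod.norm_def, max_lt_iff, Real.norm_eq_abs, Real.norm_eq_abs]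
  exact ⟨abs_lt_of_sq_lt_sq (by nlinarith [sq_nonneg z.2]) hε.le,
    abs_lt_of_sq_lt_sq (by nlinarith [sq_nonneg z.1]) hε.le⟩

theorem isCompact_closedDisk (r : ℝ) : IsCompact {z : ℝ × ℝ | z.1 ^ 2 + z.2 ^ 2 ≤ r} := by
  refine Metric.isCompact_of_isClosed_isBounded
    (isClosed_le (by fun_prop) continuous_const) ?_
  refine (Metric.isBounded_closedBall (x := (0 : ℝ × ℝ)) (r := √r)).subset fun z hz => ?_
  simp only [mem_ofPred_eq] at hz
  rw [mem_closedBall_zero_iff, Prod.norm_def, max_le_iff, Real.norm_eq_abs, Real.norm_eq_abs]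
  exact ⟨Real.abs_le_sqrt (by nlinarith [sq_nonneg z.2]),
    Real.abs_le_sqrt (by nlinarith [sq_nonneg z.1])⟩

/-- The preimage of a circle under a local homeomorphism encloses the preimage of its centre. -/
theorem encloses_of_circle (h : OpenPartialHomeomorph (ℝ × ℝ) (ℝ × ℝ)) {p : ℝ × ℝ}
    (hp : p ∈ h.source) (hp0 : h p = 0) {r : ℝ} (hr : 0 < r)
    (hsub : {z : ℝ × ℝ | z.1 ^ 2 + z.2 ^ 2 ≤ r} ⊆ h.target) :
    Encloses (h.symm '' {z | z.1 ^ 2 + z.2 ^ 2 = r}) p := by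
  set K : Set (ℝ × ℝ) := {z | z.1 ^ 2 + z.2 ^ 2 ≤ r}
  set D : Set (ℝ × ℝ) := {z | z.1 ^ 2 + z.2 ^ 2 < r}
  set C : Set (ℝ × ℝ) := {z | z.1 ^ 2 + z.2 ^ 2 = r}
  have hDK : D ⊆ K := fun z hz => le_of_lt (show z.1 ^ 2 + z.2 ^ 2 < r from hz)
  have hp' : h.symm 0 = p := by rw [← hp0, h.left_inv hp]
  have hKc : IsCompact (h.symm '' K) :=
    (isCompact_closedDisk r).image_of_continuousOn (h.continuousOn_symm.mono hsub)
  have hDo : IsOpen (h.symm '' D) := h.isOpen_image_symm_of_subset_target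
    (isOpen_lt (by fun_prop) continuous_const) (hDK.trans hsub)
  have hpD : p ∈ h.symm '' D := ⟨0, by simpa [D] using hr, hp'⟩
  have hpC : p ∉ h.symm '' C := by
    rintro ⟨z, hz, hzp⟩
    have hzK : z ∈ K := le_of_eq (show z.1 ^ 2 + z.2 ^ 2 = r from hz)
    have hz0 : z = 0 := by rw [← h.right_inv (hsub hzK), hzp, hp0]
    rw [hz0] at hz
    simp only [C, mem_ofPred_eq, Prod.fst_zero, Prod.snd_zero] at hz
    linarith
  refine ⟨hpC, (hKc.isBounded.subset (image_mono hDK)).subset ?_⟩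
  -- The images of the open disk and the complement of the image of the closed disk are disjoint
  -- open sets covering the complement of the curve, so the component of `p` stays in the former.
  refine IsPreconnected.subset_left_of_subset_union hDo hKc.isClosed.isOpen_compl
    (disjoint_compl_right.mono_left (image_mono hDK)) ?_ ?_ isPreconnected_connectedComponentIn
  · refine (connectedComponentIn_subset _ _).trans fun z hz => ?_
    by_cases hzK : z ∈ h.symm '' K
    · obtain ⟨w, hw, rfl⟩ := hzK
      exact Or.inl ⟨w, lt_of_le_of_ne hw fun hwC => hz ⟨w, hwC, rfl⟩, rfl⟩
    · exact Or.inr hzK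
  · exact ⟨p, mem_connectedComponentIn hpC, hpD⟩

/-- A periodic solution through a point of a circle, transported by an orbital diffeomorphism. -/
theorem IsOrbitalDiffeo.exists_periodic {X : ℝ × ℝ → ℝ × ℝ}
    {h : OpenPartialHomeomorph (ℝ × ℝ) (ℝ × ℝ)} {m : ℝ × ℝ → ℝ}
    (H : IsOrbitalDiffeo X (fun z => (z.2, -z.1)) h m) {z : ℝ × ℝ} {r : ℝ} (hr : 0 < r)
    (hz : z.1 ^ 2 + z.2 ^ 2 = r) (hsub : {z : ℝ × ℝ | z.1 ^ 2 + z.2 ^ 2 ≤ r} ⊆ h.target) :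
    ∃ (γ : ℝ → ℝ × ℝ) (T : ℝ), γ 0 = h.symm z ∧ (∀ t, HasDerivAt γ (X (γ t)) t) ∧
        0 < T ∧ Function.Periodic γ T ∧ range γ = h.symm '' {z | z.1 ^ 2 + z.2 ^ 2 = r} := by
  have hmem : ∀ s, rotation z s ∈ h.target := fun s =>
    hsub (by rw [mem_ofPred_eq, rotation_sq, hz])
  have hrc : Continuous (rotation z) :=
    continuous_iff_continuousAt.2 fun s => (hasDerivAt_rotation z s).continuousAt
  -- `g` is the time spent per unit of rotation angle; one turn takes the time `τ (2π)`, the period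
  -- of the orbit.
  set g : ℝ → ℝ := fun s => (m (h.symm (rotation z s)))⁻¹
  have hg : Continuous g := by
    rw [← continuousOn_univ]
    exact H.symm.continuousOn.comp hrc.continuousOn fun s _ => hmem s
  have hgpos : ∀ s, 0 < g s := fun s => H.symm.pos _ (hmem s)
  have hgper : Function.Periodic g (2 * Real.pi) := by
    intro s
    simp only [g, rotation_periodic z s]
  have hint : ∀ t₁ t₂, IntervalIntegrable g MeasureTheory.volume t₁ t₂ :=
    fun t₁ t₂ => hg.intervalIntegrable t₁ t₂
  set τ : ℝ → ℝ := fun t => ∫ s in (0 : ℝ)..t, g s with hτ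
  obtain ⟨hmono, hcont, σ, hσ⟩ := exists_inverse_of_primitive isOpen_univ ordConnected_univ
    hg.continuousOn (fun t _ => hgpos t) (mem_univ 0) hτ
  have hτ0 : τ 0 = 0 := by simp [τ]
  -- The integral of a positive periodic function is unbounded in both directions, so the solution
  -- is defined for all time.
  have hsurj : Function.Surjective τ :=
    (continuousOn_univ.1 hcont).surjective
      (hgper.tendsto_atTop_intervalIntegral_of_pos' (hint _ _) hgpos Real.two_pi_pos)
      (hgper.tendsto_atBot_intervalIntegral_of_pos' (hint _ _) hgpos Real.two_pi_pos)
  have hadd : ∀ s, τ (s + 2 * Real.pi) = τ s + τ (2 * Real.pi) := by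
    intro s
    have := hgper.intervalIntegral_add_eq_add 0 s hint
    rwa [zero_add] at this
  refine ⟨fun t => h.symm (rotation z (σ t)), τ (2 * Real.pi), ?_, ?_, ?_, ?_, ?_⟩
  · have := (hσ 0 (mem_univ _)).1
    rw [hτ0] at this
    simp only [this, rotation_zero]
  · intro t
    obtain ⟨s, rfl⟩ := hsurj t
    obtain ⟨hσs, hσd⟩ := hσ s (mem_univ _)
    obtain ⟨L, hL, hLX⟩ := H.symm.hasFDerivAt _ (hmem s)
    have h₁ := HasDerivAt.scomp _ (by rw [hσs]; exact hasDerivAt_rotation z s) hσd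
    have h₂ := HasFDerivAt.comp_hasDerivAt _ (f := rotation z ∘ σ)
      (by simp only [Function.comp_apply]; rw [hσs]; exact hL) h₁
    rw [map_smul, ContinuousLinearEquiv.coe_coe, hLX, smul_smul,
      inv_mul_cancel₀ (hgpos s).ne', one_smul] at h₂
    beta_reduce
    rw [hσs]
    exact h₂
  · rw [← hτ0]
    exact hmono (mem_univ _) (mem_univ _) Real.two_pi_pos
  · intro t
    obtain ⟨s, rfl⟩ := hsurj t
    simp only [← hadd, (hσ _ (mem_univ _)).1, rotation_periodic z s]
  · refine Subset.antisymm ?_ ?_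
    · rintro _ ⟨t, rfl⟩
      exact ⟨_, (rotation_sq z _).trans hz, rfl⟩
    · rintro _ ⟨w, hw, rfl⟩
      obtain ⟨s, rfl⟩ := exists_rotation_eq (z := z) (q := w) (by rwa [hz]) (by rw [hz]; exact hw)
      exact ⟨τ s, by simp only [(hσ s (mem_univ _)).1]⟩

theorem IsOrbitalDiffeo.isCenter {X : ℝ × ℝ → ℝ × ℝ}
    {h : OpenPartialHomeomorph (ℝ × ℝ) (ℝ × ℝ)} {m : ℝ × ℝ → ℝ}
    (H : IsOrbitalDiffeo X (fun z => (z.2, -z.1)) h m) {p : ℝ × ℝ} (hp : p ∈ h.source)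
    (hp0 : h p = 0) (hXp : X p = 0) : IsCenter X p := by
  refine ⟨hXp, fun W hW => ?_⟩
  have h0 : (0 : ℝ × ℝ) ∈ h.target := hp0 ▸ h.map_source hp
  have hA : h.target ∩ h.symm ⁻¹' W ∈ 𝓝 (0 : ℝ × ℝ) := by
    refine inter_mem (h.open_target.mem_nhds h0) ((h.continuousAt_symm h0).preimage_mem_nhds ?_)
    rwa [← hp0, h.left_inv hp]
  obtain ⟨R, hR, hRA⟩ := exists_disk_subset hA
  have hU : h.source ∩ h ⁻¹' {z | z.1 ^ 2 + z.2 ^ 2 < R} ∈ 𝓝 p := by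
    refine inter_mem (h.open_source.mem_nhds hp) ((h.continuousAt hp).preimage_mem_nhds ?_)
    refine (isOpen_lt (by fun_prop) continuous_const).mem_nhds ?_
    simpa [hp0] using hR
  refine ⟨_, hU, fun q hq hqp => ?_⟩
  have hr : 0 < (h q).1 ^ 2 + (h q).2 ^ 2 := by
    by_contra! hle
    have h₁ : (h q).1 = 0 := by nlinarith [sq_nonneg (h q).1, sq_nonneg (h q).2]
    have h₂ : (h q).2 = 0 := by nlinarith [sq_nonneg (h q).1, sq_nonneg (h q).2]
    exact hqp (h.injOn hq.1 hp (by rw [hp0]; exact Prod.ext h₁ h₂))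
  have hsub : {z : ℝ × ℝ | z.1 ^ 2 + z.2 ^ 2 ≤ (h q).1 ^ 2 + (h q).2 ^ 2} ⊆
      h.target ∩ h.symm ⁻¹' W := fun z hz => hRA (lt_of_le_of_lt (mem_ofPred_eq ▸ hz) hq.2 :)
  obtain ⟨γ, T, h₀, hd, hT, hper, hrange⟩ :=
    H.exists_periodic hr rfl (hsub.trans inter_subset_left)
  refine ⟨γ, T, by rw [h₀, h.left_inv hq.1], hd, hT, hper, ?_, ?_⟩
  · rw [hrange]
    rintro _ ⟨z, hz, rfl⟩
    exact (hsub (le_of_eq hz)).2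
  · rw [hrange]
    exact encloses_of_circle h hp hp0 hr (hsub.trans inter_subset_left)

end KaupBoussinesq

namespace KaupBoussinesq

/-! ### Straightening the system near an equilibrium. -/

/-- The invertible lower triangular linear map with diagonal entries `A`, `D`. -/
noncomputable def triangular (A B D : ℝ) (hA : A ≠ 0) (hD : D ≠ 0) : (ℝ × ℝ) ≃L[ℝ] (ℝ × ℝ) :=
  ContinuousLinearEquiv.equivOfInverse
    ((A • ContinuousLinearMap.fst ℝ ℝ ℝ).prod
      (B • ContinuousLinearMap.fst ℝ ℝ ℝ + D • ContinuousLinearMap.snd ℝ ℝ ℝ))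
    ((A⁻¹ • ContinuousLinearMap.fst ℝ ℝ ℝ).prod
      (-(B * A⁻¹ * D⁻¹) • ContinuousLinearMap.fst ℝ ℝ ℝ + D⁻¹ • ContinuousLinearMap.snd ℝ ℝ ℝ))
    (fun v => by
      refine Prod.ext ?_ ?_
      · simp [hA]
      · simp
        field_simp
        ring)
    (fun v => by
      refine Prod.ext ?_ ?_
      · simp [hA]
      · simp
        field_simp
        ring)

theorem triangular_apply (A B D : ℝ) (hA : A ≠ 0) (hD : D ≠ 0) (v : ℝ × ℝ) :
    triangular A B D hA hD v = (A * v.1, B * v.1 + D * v.2) := rfl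

theorem hasStrictFDerivAt_straighten {c η : ℝ} {ψ : ℝ → ℝ} {z : ℝ × ℝ} {A : ℝ}
    (hψ : HasStrictDerivAt ψ A z.1) (hA : A ≠ 0) (hD : η * (z.1 - c) ≠ 0) :
    HasStrictFDerivAt (fun q : ℝ × ℝ => (ψ q.1, η * (q.1 - c) * q.2))
      (triangular A (η * z.2) (η * (z.1 - c)) hA hD : ℝ × ℝ →L[ℝ] ℝ × ℝ) z := by
  have h₁ : HasStrictFDerivAt (fun q : ℝ × ℝ => ψ q.1) (A • ContinuousLinearMap.fst ℝ ℝ ℝ) z :=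
    hψ.comp_hasStrictFDerivAt z hasStrictFDerivAt_fst
  have h₂ : HasStrictFDerivAt (fun q : ℝ × ℝ => η * (q.1 - c) * q.2)
      ((η * (z.1 - c)) • ContinuousLinearMap.snd ℝ ℝ ℝ +
        z.2 • (η • ContinuousLinearMap.fst ℝ ℝ ℝ)) z :=
    (((hasStrictFDerivAt_fst (p := z)).sub_const c).const_mul η).mul hasStrictFDerivAt_snd
  convert! h₁.prodMk h₂ using 1
  ext <;> simp [triangular_apply, mul_comm]

/-- A solution `ψ` of `ψ' N(ψ) = 2 f` straightens the system to `x' = y`, `y' = N(x)`, up to a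
positive factor. -/
theorem exists_isOrbitalDiffeo {c g₁ g₂ φ₀ η : ℝ} {N ψ : ℝ → ℝ} (hη : η * η = 1)
    (hψ : ContDiffAt ℝ 1 ψ φ₀) (hψ0 : ψ φ₀ = 0) (hpos : 0 < η * (φ₀ - c) * deriv ψ φ₀)
    (heq : ∀ᶠ φ in 𝓝 φ₀, 2 * cubic c g₁ g₂ φ = deriv ψ φ * N (ψ φ)) :
    ∃ (h : OpenPartialHomeomorph (ℝ × ℝ) (ℝ × ℝ)) (m : ℝ × ℝ → ℝ),
      (φ₀, 0) ∈ h.source ∧ h (φ₀, 0) = 0 ∧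
      IsOrbitalDiffeo (field c g₁ g₂) (fun z => (z.2, N z.1)) h m := by
  have hdc : ∀ {x}, ContDiffAt ℝ 1 ψ x → ContinuousAt (deriv ψ) x := by
    intro x hx
    exact (ContinuousLinearMap.apply ℝ ℝ (1 : ℝ)).continuous.continuousAt.comp
      (hx.continuousAt_fderiv one_ne_zero)
  have hstrict : ∀ {x}, ContDiffAt ℝ 1 ψ x → HasStrictDerivAt ψ (deriv ψ x) x :=
    fun hx => hx.hasStrictDerivAt one_ne_zero
  have hpos' : ∀ᶠ φ in 𝓝 φ₀, 0 < η * (φ - c) * deriv ψ φ := by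
    have hc : ContinuousAt (fun φ => η * (φ - c) * deriv ψ φ) φ₀ :=
      ContinuousAt.mul (by fun_prop) (hdc hψ)
    exact hc.eventually (lt_mem_nhds hpos)
  obtain ⟨O, hO, hOo, hφO⟩ := mem_nhds_iff.1 (heq.and (hpos'.and (hψ.eventually (by simp))))
  have hne : ∀ {x}, x ∈ O → deriv ψ x ≠ 0 ∧ η * (x - c) ≠ 0 := fun hx =>
    ⟨right_ne_zero_of_mul (hO hx).2.1.ne', left_ne_zero_of_mul (hO hx).2.1.ne'⟩
  have h₀ := hasStrictFDerivAt_straighten (c := c) (η := η) (z := (φ₀, 0)) (hstrict hψ)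
    (hne hφO).1 (hne hφO).2
  -- The differential equation for `ψ`, its smoothness and the sign of `m` involve `φ` alone, so
  -- cutting down to a vertical strip suffices.
  refine ⟨(h₀.toOpenPartialHomeomorph _).restrOpen (Prod.fst ⁻¹' O) (hOo.preimage continuous_fst),
    fun z => 1 / 2 * (η * (z.1 - c) * deriv ψ z.1), ?_, ?_, ?_, ?_, ?_⟩
  · rw [OpenPartialHomeomorph.restrOpen_source]
    exact ⟨h₀.mem_toOpenPartialHomeomorph_source, hφO⟩
  · change (ψ φ₀, η * (φ₀ - c) * 0) = 0
    rw [hψ0, mul_zero]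
    rfl
  · rw [OpenPartialHomeomorph.restrOpen_source]
    intro z hz
    refine ContinuousAt.continuousWithinAt ?_
    have hd : ContinuousAt (fun z : ℝ × ℝ => deriv ψ z.1) z :=
      ContinuousAt.comp (f := Prod.fst) (hdc (hO hz.2).2.2) continuousAt_fst
    exact continuousAt_const.mul (ContinuousAt.mul (by fun_prop) hd)
  · rw [OpenPartialHomeomorph.restrOpen_source]
    intro z hz
    have := (hO hz.2).2.1
    positivity
  · rw [OpenPartialHomeomorph.restrOpen_source]
    intro z hz
    have hf := (hO hz.2).1
    refine ⟨_, (hasStrictFDerivAt_straighten (c := c) (η := η) (z := z) (hstrict (hO hz.2).2.2)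
      (hne hz.2).1 (hne hz.2).2).hasFDerivAt, ?_⟩
    change _ = (1 / 2 * (η * (z.1 - c) * deriv ψ z.1)) • (η * (z.1 - c) * z.2, N (ψ z.1))
    rw [triangular_apply]
    refine Prod.ext ?_ ?_
    · simp only [field, Prod.smul_mk, smul_eq_mul]
      linear_combination (-(1 / 2) * deriv ψ z.1 * (z.1 - c) ^ 2 * z.2) * hη
    · simp only [field, cubic, coeffA, coeffB, Prod.smul_mk, smul_eq_mul] at hf ⊢
      linear_combination (1 / 2 * η * (z.1 - c)) * hf

/-- A differentiable positive `n`-th root of a function near a point where it is positive. -/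
theorem exists_contDiffAt_root {n : ℕ} (hn : n ≠ 0) {P P' : ℝ → ℝ} {φ₀ : ℝ} (hP : ContDiff ℝ 1 P)
    (hP' : ∀ φ, HasDerivAt P (P' φ) φ) (hpos : 0 < P φ₀) :
    ∃ R : ℝ → ℝ, ContDiffAt ℝ 1 R φ₀ ∧ 0 < R φ₀ ∧
      ∀ᶠ φ in 𝓝 φ₀, HasDerivAt R (deriv R φ) φ ∧ R φ ^ n = P φ ∧
        n * R φ ^ (n - 1) * deriv R φ = P' φ := by
  have hev : ∀ᶠ φ in 𝓝 φ₀, 0 < P φ := hP.continuous.continuousAt.eventually (lt_mem_nhds hpos)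
  have hpow : ∀ᶠ φ in 𝓝 φ₀, (P φ ^ (n : ℝ)⁻¹) ^ n = P φ := by
    filter_upwards [hev] with φ hφ using Real.rpow_inv_natCast_pow hφ.le hn
  have hR : ∀ φ, 0 < P φ → ContDiffAt ℝ 1 (fun φ => P φ ^ (n : ℝ)⁻¹) φ := fun φ hφ =>
    hP.contDiffAt.rpow_const_of_ne hφ.ne'
  refine ⟨fun φ => P φ ^ (n : ℝ)⁻¹, hR φ₀ hpos, Real.rpow_pos_of_pos hpos _, ?_⟩
  -- `R ^ n = P` holds on a whole neighbourhood of each nearby `φ`, so it may be differentiated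
  -- there.
  filter_upwards [hev, hpow.eventually_nhds] with φ hφ hφpow
  have hd := ((hR φ hφ).differentiableAt one_ne_zero).hasDerivAt
  exact ⟨hd, hφpow.self_of_nhds, (hd.fun_pow n).unique ((hP' φ).congr_of_eventuallyEq hφpow)⟩

theorem exists_sign {t : ℝ} (ht : t ≠ 0) : ∃ η : ℝ, η * η = 1 ∧ 0 < η * t := by
  rcases ht.lt_or_gt with h | h
  · exact ⟨-1, by norm_num, by linarith⟩
  · exact ⟨1, by norm_num, by linarith⟩

/-- The derivative of the cubic. -/
def cubicDeriv (c g₁ g₂ φ : ℝ) : ℝ := -3 * φ ^ 2 + 2 * c * φ + coeffA g₁ g₂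

theorem cubic_eq_of_root {c g₁ g₂ φ₀ : ℝ} (h₀ : cubic c g₁ g₂ φ₀ = 0) (φ : ℝ) :
    cubic c g₁ g₂ φ = cubicDeriv c g₁ g₂ φ₀ * (φ - φ₀) + (c - 3 * φ₀) * (φ - φ₀) ^ 2 -
      (φ - φ₀) ^ 3 := by
  rw [← sub_zero (cubic c g₁ g₂ φ), ← h₀]
  simp only [cubic, cubicDeriv]
  ring

/-- Near a nondegenerate equilibrium the system is orbitally equivalent to `x' = y`, `y' = ± x`. -/
theorem exists_isOrbitalDiffeo_of_deriv_ne_zero {c g₁ g₂ φ₀ ε : ℝ} (hφc : φ₀ ≠ c)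
    (h₀ : cubic c g₁ g₂ φ₀ = 0) (hε : ε * ε = 1) (hk : 0 < ε * cubicDeriv c g₁ g₂ φ₀) :
    ∃ (h : OpenPartialHomeomorph (ℝ × ℝ) (ℝ × ℝ)) (m : ℝ × ℝ → ℝ),
      (φ₀, 0) ∈ h.source ∧ h (φ₀, 0) = 0 ∧
      IsOrbitalDiffeo (field c g₁ g₂) (fun z => (z.2, ε * z.1)) h m := by
  set k := cubicDeriv c g₁ g₂ φ₀ with hkdef
  -- For `N(x) = ε x` integration gives `ψ² = 4 ε ∫ f = (φ - φ₀)² P`, whence `ψ = (φ - φ₀) √P`; here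
  -- `P(φ₀) = 2 ε k > 0`.
  obtain ⟨R, hRc, hRpos, hR⟩ := exists_contDiffAt_root two_ne_zero (φ₀ := φ₀)
    (P := fun φ => ε * (2 * k + 4 / 3 * (c - 3 * φ₀) * (φ - φ₀) - (φ - φ₀) ^ 2))
    (P' := fun φ => ε * (4 / 3 * (c - 3 * φ₀) - 2 * (φ - φ₀))) (by fun_prop)
    (fun φ => by
      have h₁ := (hasDerivAt_id φ).sub_const φ₀
      convert! ((((h₁.const_mul (4 / 3 * (c - 3 * φ₀))).const_add (2 * k)).sub
        (h₁.pow 2)).const_mul ε) using 1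
      simp)
    (by simp only [sub_self]; linarith)
  obtain ⟨η, hη, hηpos⟩ := exists_sign (sub_ne_zero.2 hφc)
  have hderiv : ∀ᶠ φ in 𝓝 φ₀, deriv (fun φ => (φ - φ₀) * R φ) φ =
      R φ + (φ - φ₀) * deriv R φ := by
    filter_upwards [hR] with φ hφ
    simpa using (((hasDerivAt_id φ).sub_const φ₀).fun_mul hφ.1).deriv
  refine exists_isOrbitalDiffeo (ψ := fun φ => (φ - φ₀) * R φ) (N := fun x => ε * x) hη
    (ContDiffAt.mul (by fun_prop) hRc) (by simp) ?_ ?_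
  · rw [hderiv.self_of_nhds]
    simpa using mul_pos hηpos hRpos
  · filter_upwards [hR, hderiv] with φ ⟨_, h₁, h₂⟩ h₃
    rw [h₃, cubic_eq_of_root h₀, ← hkdef]
    simp only [Nat.cast_ofNat, Nat.add_one_sub_one, pow_one] at h₁ h₂
    linear_combination (-(φ - φ₀) * ε) * h₁ - (φ - φ₀) ^ 2 * ε / 2 * h₂ - (2 * k * (φ - φ₀) +
      2 * (c - 3 * φ₀) * (φ - φ₀) ^ 2 - 2 * (φ - φ₀) ^ 3) * hε

/-- Near a double root of the cubic the system is orbitally equivalent to the standard cusp. -/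
theorem exists_isOrbitalDiffeo_of_deriv_eq_zero {c g₁ g₂ φ₀ : ℝ} (hφc : φ₀ ≠ c)
    (h₀ : cubic c g₁ g₂ φ₀ = 0) (hk : cubicDeriv c g₁ g₂ φ₀ = 0) (hl : c - 3 * φ₀ ≠ 0) :
    ∃ (h : OpenPartialHomeomorph (ℝ × ℝ) (ℝ × ℝ)) (m : ℝ × ℝ → ℝ),
      (φ₀, 0) ∈ h.source ∧ h (φ₀, 0) = 0 ∧
      IsOrbitalDiffeo (field c g₁ g₂) (fun z => (z.2, z.1 ^ 2)) h m := by
  obtain ⟨ε, hε, hεpos⟩ := exists_sign hl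
  -- For `N(x) = x²` integration gives `ψ³ = 6 ∫ f = (φ - φ₀)³ ε P`; the sign `ε` makes `P(φ₀)`
  -- positive, and `ψ = ε (φ - φ₀) P^(1/3)`.
  obtain ⟨R, hRc, hRpos, hR⟩ := exists_contDiffAt_root three_ne_zero (φ₀ := φ₀)
    (P := fun φ => ε * (2 * (c - 3 * φ₀) - 3 / 2 * (φ - φ₀)))
    (P' := fun _ => ε * (-(3 / 2))) (by fun_prop)
    (fun φ => by
      have h₁ := (hasDerivAt_id φ).sub_const φ₀
      convert! (((h₁.const_mul (3 / 2)).const_sub (2 * (c - 3 * φ₀))).const_mul ε) using 1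
      simp)
    (by simp only [sub_self]; linarith)
  have hε0 : ε ≠ 0 := left_ne_zero_of_mul hεpos.ne'
  -- `ψ'(φ₀)` has the sign of `ε`, which `η` must compensate along with that of `φ₀ - c`.
  obtain ⟨η, hη, hηpos⟩ := exists_sign (mul_ne_zero hε0 (sub_ne_zero.2 hφc))
  have hderiv : ∀ᶠ φ in 𝓝 φ₀, deriv (fun φ => ε * ((φ - φ₀) * R φ)) φ =
      ε * (R φ + (φ - φ₀) * deriv R φ) := by
    filter_upwards [hR] with φ hφ
    simpa using ((((hasDerivAt_id φ).sub_const φ₀).fun_mul hφ.1).const_mul ε).deriv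
  refine exists_isOrbitalDiffeo (ψ := fun φ => ε * ((φ - φ₀) * R φ)) (N := fun x => x ^ 2) hη
    (contDiffAt_const.mul (ContDiffAt.mul (by fun_prop) hRc)) (by simp) ?_ ?_
  · rw [hderiv.self_of_nhds]
    have := mul_pos hηpos hRpos
    simp only [sub_self, zero_mul, add_zero]
    linarith
  · filter_upwards [hR, hderiv] with φ ⟨_, h₁, h₂⟩ h₃
    rw [h₃, cubic_eq_of_root h₀, hk]
    simp only [Nat.cast_ofNat, Nat.add_one_sub_one] at h₁ h₂
    have hε3 : ε ^ 3 = ε := by linear_combination ε * hε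
    have h₄ : ε * (R φ + (φ - φ₀) * deriv R φ) * (ε * ((φ - φ₀) * R φ)) ^ 2 =
        ε ^ 3 * ((φ - φ₀) ^ 2 * R φ ^ 3 + (φ - φ₀) ^ 3 * (R φ ^ 2 * deriv R φ)) := by ring
    rw [h₄, hε3]
    linear_combination (-(φ - φ₀) ^ 2 * ε) * h₁ - (φ - φ₀) ^ 3 * ε / 3 * h₂ -
      (2 * (c - 3 * φ₀) * (φ - φ₀) ^ 2 - 2 * (φ - φ₀) ^ 3) * hε

/-! ### Types of the equilibria. -/

theorem field_eq_zero_iff {c g₁ g₂ : ℝ} (hc : c ≠ 0) (hg₂ : g₂ ≠ 0) (q : ℝ × ℝ) :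
    field c g₁ g₂ q = 0 ↔ cubic c g₁ g₂ q.1 = 0 ∧ q.2 = 0 := by
  simp only [field, Prod.mk_eq_zero, cubic, coeffA, coeffB]
  constructor
  · rintro ⟨h₁, h₂⟩
    have hq : q.1 - c ≠ 0 := by
      intro h
      have hq1 : q.1 = c := by linarith
      rw [h, hq1] at h₂
      have : g₂ * c = 0 := by linarith
      simp_all
    have hy : q.2 = 0 := by simpa [hq] using h₁
    rw [hy] at h₂
    exact ⟨by linear_combination h₂, hy⟩
  · rintro ⟨h₁, h₂⟩
    rw [h₂]
    exact ⟨by ring, by linear_combination h₁⟩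

/-- `f(c) = -2 c g₂` does not vanish. -/
theorem ne_of_cubic_eq_zero {c g₁ g₂ φ₀ : ℝ} (hc : c ≠ 0) (hg₂ : g₂ ≠ 0)
    (h₀ : cubic c g₁ g₂ φ₀ = 0) : φ₀ ≠ c := by
  rintro rfl
  simp only [cubic, coeffA, coeffB] at h₀
  have : g₂ * φ₀ = 0 := by linarith
  simp_all

theorem isCenter_field {c g₁ g₂ φ₀ : ℝ} (hc : c ≠ 0) (hg₂ : g₂ ≠ 0)
    (h₀ : cubic c g₁ g₂ φ₀ = 0) (hk : cubicDeriv c g₁ g₂ φ₀ < 0) :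
    IsCenter (field c g₁ g₂) (φ₀, 0) := by
  obtain ⟨h, m, hp, hp0, H⟩ := exists_isOrbitalDiffeo_of_deriv_ne_zero (ε := -1)
    (ne_of_cubic_eq_zero hc hg₂ h₀) h₀ (by norm_num) (by linarith)
  simp only [neg_one_mul] at H
  exact H.isCenter hp hp0 ((field_eq_zero_iff hc hg₂ _).2 ⟨h₀, rfl⟩)

theorem hasFDerivAt_field (c g₁ g₂ φ₀ : ℝ) :
    HasFDerivAt (field c g₁ g₂)
      (((1 / 2 * (φ₀ - c) ^ 2) • ContinuousLinearMap.snd ℝ ℝ ℝ).prod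
        (cubicDeriv c g₁ g₂ φ₀ • ContinuousLinearMap.fst ℝ ℝ ℝ)) (φ₀, 0) := by
  have hx : HasFDerivAt (fun q : ℝ × ℝ => q.1) (ContinuousLinearMap.fst ℝ ℝ ℝ) (φ₀, (0 : ℝ)) :=
    hasFDerivAt_fst
  have hy : HasFDerivAt (fun q : ℝ × ℝ => q.2) (ContinuousLinearMap.snd ℝ ℝ ℝ) (φ₀, (0 : ℝ)) :=
    hasFDerivAt_snd
  have h₁ := (((hx.sub_const c).pow 2).const_mul (1 / 2)).mul hy
  have h₂ := ((hx.sub_const c).mul ((((hy.pow 2).const_mul (1 / 2)).const_sub g₁).sub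
    (hx.pow 2))).sub (hx.const_mul (2 * g₂))
  convert! h₁.prodMk h₂ using 1
  ext <;> simp [cubicDeriv, coeffA]
  ring

theorem isSaddle_field {c g₁ g₂ φ₀ : ℝ} (hc : c ≠ 0) (hg₂ : g₂ ≠ 0)
    (h₀ : cubic c g₁ g₂ φ₀ = 0) (hk : 0 < cubicDeriv c g₁ g₂ φ₀) :
    IsSaddle (field c g₁ g₂) (φ₀, 0) := by
  have hφc := ne_of_cubic_eq_zero hc hg₂ h₀
  have hu : 0 < 1 / 2 * (φ₀ - c) ^ 2 := by
    have := sub_ne_zero.2 hφc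
    positivity
  refine ⟨(field_eq_zero_iff hc hg₂ _).2 ⟨h₀, rfl⟩, ?_, ?_⟩
  · have hs : 0 < √(1 / 2 * (φ₀ - c) ^ 2 * cubicDeriv c g₁ g₂ φ₀) :=
      Real.sqrt_pos.2 (mul_pos hu hk)
    have hsq := Real.sq_sqrt (mul_pos hu hk).le
    have heig : ∀ l : ℝ, l ^ 2 = 1 / 2 * (φ₀ - c) ^ 2 * cubicDeriv c g₁ g₂ φ₀ →
        Module.End.HasEigenvalue
          (fderiv ℝ (field c g₁ g₂) (φ₀, 0) : ℝ × ℝ →ₗ[ℝ] ℝ × ℝ) l := by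
      intro l hl
      -- The linearization is `(v, w) ↦ (u w, k v)` with `u = (φ₀ - c)² / 2` and `k = f'(φ₀)`; if
      -- `l² = u k`, then `(u, l)` is an eigenvector.
      refine Module.End.hasEigenvalue_of_hasEigenvector (x := (1 / 2 * (φ₀ - c) ^ 2, l)) ?_
      rw [Module.End.hasEigenvector_iff, Module.End.mem_eigenspace_iff,
        (hasFDerivAt_field c g₁ g₂ φ₀).fderiv]
      refine ⟨Prod.ext ?_ ?_, fun h => hu.ne' (congrArg Prod.fst h)⟩
      · simp
        ring
      · simp
        linear_combination -hl
    exact ⟨_, _, neg_lt_zero.2 hs, hs, heig _ (by rw [neg_sq, hsq]), heig _ hsq⟩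
  · obtain ⟨h, m, hp, hp0, H⟩ := exists_isOrbitalDiffeo_of_deriv_ne_zero (ε := 1)
      hφc h₀ (by norm_num) (by linarith)
    simp only [one_mul] at H
    exact H.locallyEquivalent hp hp0

/-- A field that on small circles never points in the direction `(0, -ε)`, with `ε = ± 1`, has
index zero. -/
theorem hasPoincareIndex_zero {X : ℝ × ℝ → ℝ × ℝ} (hX : Continuous X) {p : ℝ × ℝ} {ε r₀ : ℝ}
    (hε : ε * ε = 1) (hr₀ : 0 < r₀)
    (hdir : ∀ r t : ℝ, 0 < r → r < r₀ →
      0 < ε * (X (p + (r * Real.cos t, r * Real.sin t))).2 ∨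
        (X (p + (r * Real.cos t, r * Real.sin t))).1 ≠ 0) :
    HasPoincareIndex X p 0 := by
  refine ⟨r₀, hr₀, fun r hr hrr => ?_⟩
  set V : ℝ → ℝ × ℝ := fun t => X (p + (r * Real.cos t, r * Real.sin t)) with hV
  have hVc : Continuous V := by fun_prop
  -- `w` is the field turned by `-ε π / 2`, which sends the omitted direction to the negative real
  -- axis. The principal argument of `w` is then continuous and, being a function of the point
  -- alone, returns to its value after one turn.
  set w : ℝ → ℂ := fun t => ⟨ε * (V t).2, -(ε * (V t).1)⟩ with hw
  have hwc : Continuous w := by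
    have : w = fun t => ((ε * (V t).2 : ℝ) : ℂ) + ((-(ε * (V t).1) : ℝ) : ℂ) * Complex.I := by
      funext t
      exact Complex.mk_eq_add_mul_I _ _
    rw [this]
    fun_prop
  have hε0 : ε ≠ 0 := left_ne_zero_of_mul (hε ▸ one_ne_zero)
  have hslit : ∀ t, w t ∈ Complex.slitPlane := by
    intro t
    rw [Complex.mem_slitPlane_iff]
    rcases hdir r t hr hrr with h | h
    · exact Or.inl h
    · exact Or.inr (neg_ne_zero.2 (mul_ne_zero hε0 h))
  refine ⟨fun t => ‖w t‖, fun t => Complex.arg (w t) + ε * (Real.pi / 2), ?_, ?_, ?_, ?_⟩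
  · exact (continuous_iff_continuousAt.2 fun t =>
      (Complex.continuousAt_arg (hslit t)).comp hwc.continuousAt).add continuous_const
  · exact fun t => norm_pos_iff.2 (Complex.slitPlane_ne_zero (hslit t))
  · intro t
    have hre : ‖w t‖ * Real.cos (w t).arg = ε * (V t).2 := Complex.norm_mul_cos_arg _
    have him : ‖w t‖ * Real.sin (w t).arg = -(ε * (V t).1) := Complex.norm_mul_sin_arg _
    have hcos : Real.cos (ε * (Real.pi / 2)) = 0 := by
      rcases mul_self_eq_one_iff.1 hε with rfl | rfl <;> simp
    have hsin : Real.sin (ε * (Real.pi / 2)) = ε := by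
      rcases mul_self_eq_one_iff.1 hε with rfl | rfl <;> simp
    change V t = _
    rw [Real.cos_add, Real.sin_add, hcos, hsin]
    refine Prod.ext ?_ ?_
    · linear_combination (-(V t).1) * hε + ε * him
    · linear_combination (-(V t).2) * hε - ε * hre
  · have : w (2 * Real.pi) = w 0 := by simp [hw, hV]
    simp [this]

theorem isCusp_field {c g₁ g₂ φ₀ : ℝ} (hc : c ≠ 0) (hg₂ : g₂ ≠ 0)
    (h₀ : cubic c g₁ g₂ φ₀ = 0) (hk : cubicDeriv c g₁ g₂ φ₀ = 0) (hl : c - 3 * φ₀ ≠ 0) :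
    IsCusp (field c g₁ g₂) (φ₀, 0) := by
  have hφc := ne_of_cubic_eq_zero hc hg₂ h₀
  refine ⟨(field_eq_zero_iff hc hg₂ _).2 ⟨h₀, rfl⟩, ?_, ?_, ?_⟩
  · rw [(hasFDerivAt_field c g₁ g₂ φ₀).fderiv, hk]
    refine LinearMap.det_eq_zero_iff_ker_ne_bot.2 fun h => ?_
    have : ((1, 0) : ℝ × ℝ) ∈ (⊥ : Submodule ℝ (ℝ × ℝ)) := by
      rw [← h, LinearMap.mem_ker]
      simp
    simp at this
  · obtain ⟨ε, hε, hεpos⟩ := exists_sign hl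
    have hXc : Continuous (field c g₁ g₂) := by
      unfold field
      fun_prop
    -- The first bound keeps the circle off the line `φ = c`, so the first component vanishes only
    -- where `sin t = 0`; the second gives `f` the sign of `ε` at `φ₀ ± r`.
    refine hasPoincareIndex_zero hXc hε (r₀ := min |φ₀ - c| (ε * (c - 3 * φ₀)))
      (lt_min (abs_pos.2 (sub_ne_zero.2 hφc)) hεpos) fun r t hr hrr => ?_
    obtain ⟨hr₁, hr₂⟩ := lt_min_iff.1 hrr
    have hcos : |r * Real.cos t| ≤ r := by
      rw [abs_mul, abs_of_pos hr]
      exact mul_le_of_le_one_right hr.le (Real.abs_cos_le_one t)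
    by_cases hs : Real.sin t = 0
    · left
      have hc2 : Real.cos t ^ 2 = 1 := by
        have := Real.sin_sq_add_cos_sq t
        rw [hs] at this
        linarith
      have hfield : (field c g₁ g₂ ((φ₀, 0) + (r * Real.cos t, r * Real.sin t))).2 =
          cubic c g₁ g₂ (φ₀ + r * Real.cos t) := by
        simp only [field, cubic, coeffA, coeffB, hs, Prod.mk_add_mk]
        ring
      rw [hfield, cubic_eq_of_root h₀, hk]
      have hx : ε * (r * Real.cos t) ≤ r := by
        refine (le_abs_self _).trans ?_
        rw [abs_mul, (abs_eq zero_le_one).2 (mul_self_eq_one_iff.1 hε), one_mul]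
        exact hcos
      have : ε * (0 * (φ₀ + r * Real.cos t - φ₀) + (c - 3 * φ₀) * (φ₀ + r * Real.cos t - φ₀) ^ 2 -
          (φ₀ + r * Real.cos t - φ₀) ^ 3) =
          r ^ 2 * (ε * (c - 3 * φ₀) - ε * (r * Real.cos t)) := by
        linear_combination (r ^ 2 * (ε * (c - 3 * φ₀) - ε * (r * Real.cos t))) * hc2
      rw [this]
      exact mul_pos (by positivity) (by linarith)
    · right
      have hu : φ₀ + r * Real.cos t - c ≠ 0 := by
        intro h
        have h' : φ₀ - c = -(r * Real.cos t) := by linarith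
        rw [h', abs_neg] at hr₁
        linarith
      simp only [field, Prod.mk_add_mk, zero_add]
      positivity
  · obtain ⟨h, m, hp, hp0, H⟩ := exists_isOrbitalDiffeo_of_deriv_eq_zero hφc h₀ hk hl
    exact H.locallyEquivalent hp hp0

end KaupBoussinesq

namespace KaupBoussinesq

/-! ### Monotonicity and roots of the cubic. -/

theorem hasDerivAt_cubic (c g₁ g₂ φ : ℝ) :
    HasDerivAt (cubic c g₁ g₂) (cubicDeriv c g₁ g₂ φ) φ := by
  have h := hasDerivAt_id φ
  convert! ((((h.pow 3).neg).add ((h.pow 2).const_mul c)).add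
    (h.const_mul (coeffA g₁ g₂))).add_const (coeffB c g₁) using 1
  simp only [cubicDeriv, id]
  push_cast
  ring

theorem continuous_cubic (c g₁ g₂ : ℝ) : Continuous (cubic c g₁ g₂) := by
  unfold cubic
  fun_prop

section Roots

variable {c g₁ g₂ s₁ s₂ : ℝ}

theorem cubicDeriv_eq (h₁ : 2 * c = 3 * (s₁ + s₂)) (h₂ : coeffA g₁ g₂ = -3 * (s₁ * s₂)) (φ : ℝ) :
    cubicDeriv c g₁ g₂ φ = -3 * ((φ - s₁) * (φ - s₂)) := by
  rw [cubicDeriv, h₂]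
  linear_combination φ * h₁

theorem strictAntiOn_cubic_Iic (hs : s₁ < s₂)
    (hd : ∀ φ, cubicDeriv c g₁ g₂ φ = -3 * ((φ - s₁) * (φ - s₂))) :
    StrictAntiOn (cubic c g₁ g₂) (Iic s₁) := by
  refine strictAntiOn_of_deriv_neg (convex_Iic _) (continuous_cubic ..).continuousOn fun x hx => ?_
  rw [interior_Iic, mem_Iio] at hx
  rw [(hasDerivAt_cubic ..).deriv, hd]
  nlinarith [mul_pos (sub_pos.2 hx) (sub_pos.2 (hx.trans hs))]

theorem strictMonoOn_cubic_Icc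
    (hd : ∀ φ, cubicDeriv c g₁ g₂ φ = -3 * ((φ - s₁) * (φ - s₂))) :
    StrictMonoOn (cubic c g₁ g₂) (Icc s₁ s₂) := by
  refine strictMonoOn_of_deriv_pos (convex_Icc ..) (continuous_cubic ..).continuousOn
    fun x hx => ?_
  rw [interior_Icc, mem_Ioo] at hx
  rw [(hasDerivAt_cubic ..).deriv, hd]
  nlinarith [mul_pos (sub_pos.2 hx.1) (sub_pos.2 hx.2)]

theorem strictAntiOn_cubic_Ici (hs : s₁ < s₂)
    (hd : ∀ φ, cubicDeriv c g₁ g₂ φ = -3 * ((φ - s₁) * (φ - s₂))) :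
    StrictAntiOn (cubic c g₁ g₂) (Ici s₂) := by
  refine strictAntiOn_of_deriv_neg (convex_Ici _) (continuous_cubic ..).continuousOn fun x hx => ?_
  rw [interior_Ici, mem_Ioi] at hx
  rw [(hasDerivAt_cubic ..).deriv, hd]
  nlinarith [mul_pos (sub_pos.2 hx) (sub_pos.2 (hs.trans hx))]

theorem exists_root_lt (hs : s₁ < s₂) (h₁ : 2 * c = 3 * (s₁ + s₂))
    (hd : ∀ φ, cubicDeriv c g₁ g₂ φ = -3 * ((φ - s₁) * (φ - s₂)))
    (hf : cubic c g₁ g₂ s₁ < 0) : ∃ φ < s₁, cubic c g₁ g₂ φ = 0 := by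
  obtain ⟨t, ht, htf⟩ : ∃ t : ℝ, 1 ≤ t ∧ -cubic c g₁ g₂ s₁ < t :=
    ⟨1 - cubic c g₁ g₂ s₁, by linarith, by linarith⟩
  -- Taylor expansion at the critical point, where `f''(s₁) / 2 = c - 3 s₁ = 3 (s₂ - s₁) / 2`. As `t
  -- ≥ 1`, the cubic term is at least `t`, which exceeds `-f(s₁)`.
  have hexp : cubic c g₁ g₂ (s₁ - t) = cubic c g₁ g₂ s₁ + 3 / 2 * (s₂ - s₁) * t ^ 2 + t ^ 3 := by
    have h' := hd s₁
    simp only [cubic, cubicDeriv] at h' ⊢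
    linear_combination -t * h' + t ^ 2 / 2 * h₁
  have hpos : 0 < cubic c g₁ g₂ (s₁ - t) := by
    have h3 : t ≤ t ^ 3 := le_self_pow₀ ht three_ne_zero
    have : 0 < (s₂ - s₁) * t ^ 2 := mul_pos (sub_pos.2 hs) (by positivity)
    linarith
  obtain ⟨φ, hφ, h0⟩ := intermediate_value_Ioo' (by linarith : s₁ - t ≤ s₁)
    (continuous_cubic c g₁ g₂).continuousOn ⟨hf, hpos⟩
  exact ⟨φ, hφ.2, h0⟩

theorem exists_root_gt (hs : s₁ < s₂) (h₁ : 2 * c = 3 * (s₁ + s₂))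
    (hd : ∀ φ, cubicDeriv c g₁ g₂ φ = -3 * ((φ - s₁) * (φ - s₂)))
    (hf : 0 < cubic c g₁ g₂ s₂) : ∃ φ, s₂ < φ ∧ cubic c g₁ g₂ φ = 0 := by
  obtain ⟨t, ht, htf⟩ : ∃ t : ℝ, 1 ≤ t ∧ cubic c g₁ g₂ s₂ < t :=
    ⟨1 + cubic c g₁ g₂ s₂, by linarith, by linarith⟩
  have hexp : cubic c g₁ g₂ (s₂ + t) = cubic c g₁ g₂ s₂ - 3 / 2 * (s₂ - s₁) * t ^ 2 - t ^ 3 := by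
    have h' := hd s₂
    simp only [cubic, cubicDeriv] at h' ⊢
    linear_combination t * h' + t ^ 2 / 2 * h₁
  have hneg : cubic c g₁ g₂ (s₂ + t) < 0 := by
    have h3 : t ≤ t ^ 3 := le_self_pow₀ ht three_ne_zero
    have : 0 < (s₂ - s₁) * t ^ 2 := mul_pos (sub_pos.2 hs) (by positivity)
    linarith
  obtain ⟨φ, hφ, h0⟩ := intermediate_value_Ioo' (by linarith : s₂ ≤ s₂ + t)
    (continuous_cubic c g₁ g₂).continuousOn ⟨hneg, hf⟩
  exact ⟨φ, hφ.1, h0⟩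

end Roots

theorem equilibria_field {c g₁ g₂ : ℝ} (hc : c ≠ 0) (hg₂ : g₂ ≠ 0) {S : Set ℝ}
    (hS : ∀ φ, cubic c g₁ g₂ φ = 0 ↔ φ ∈ S) :
    equilibria (field c g₁ g₂) = (fun φ => (φ, 0)) '' S := by
  ext ⟨φ, y⟩
  simp only [equilibria, mem_ofPred_eq, field_eq_zero_iff hc hg₂, hS, mem_image, Prod.mk.injEq]
  exact ⟨fun h => ⟨φ, h.1, rfl, h.2.symm⟩, fun ⟨x, hx, h, h'⟩ => ⟨h ▸ hx, h'.symm⟩⟩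

end KaupBoussinesq

/-! ### The five cases. -/

open KaupBoussinesq

theorem theorem1 (c g₁ g₂ : ℝ) (hc : c ≠ 0) (hg₂ : g₂ ≠ 0)
    (hΔ : 0 < 4 * c ^ 2 + 12 * KaupBoussinesq.coeffA g₁ g₂)
    (X : ℝ × ℝ → ℝ × ℝ) (hX : X = KaupBoussinesq.field c g₁ g₂)
    (s₁ s₂ f₁ f₂ : ℝ)
    (hs₁ : s₁ = KaupBoussinesq.phiStar₁ c g₁ g₂) (hs₂ : s₂ = KaupBoussinesq.phiStar₂ c g₁ g₂)
    (hf₁ : f₁ = KaupBoussinesq.cubic c g₁ g₂ s₁) (hf₂ : f₂ = KaupBoussinesq.cubic c g₁ g₂ s₂) :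
    (f₂ < 0 → ∃ φ₁ : ℝ, φ₁ < s₁ ∧ s₁ < s₂ ∧
      KaupBoussinesq.equilibria X = {(φ₁, 0)} ∧ KaupBoussinesq.IsCenter X (φ₁, 0)) ∧
    (0 < f₁ → ∃ φ₂ : ℝ, s₁ < s₂ ∧ s₂ < φ₂ ∧
      KaupBoussinesq.equilibria X = {(φ₂, 0)} ∧ KaupBoussinesq.IsCenter X (φ₂, 0)) ∧
    (f₁ = 0 → ∃ φ₃ φ₄ : ℝ, φ₃ = s₁ ∧ s₁ < s₂ ∧ s₂ < φ₄ ∧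
      KaupBoussinesq.equilibria X = {(φ₃, 0), (φ₄, 0)} ∧
      KaupBoussinesq.IsCusp X (φ₃, 0) ∧ KaupBoussinesq.IsCenter X (φ₄, 0)) ∧
    (f₂ = 0 → ∃ φ₅ φ₆ : ℝ, φ₅ < s₁ ∧ s₁ < s₂ ∧ s₂ = φ₆ ∧
      KaupBoussinesq.equilibria X = {(φ₅, 0), (φ₆, 0)} ∧
      KaupBoussinesq.IsCenter X (φ₅, 0) ∧ KaupBoussinesq.IsCusp X (φ₆, 0)) ∧
    (f₁ < 0 → 0 < f₂ → ∃ φ₇ φ₈ φ₉ : ℝ, φ₇ < s₁ ∧ s₁ < φ₈ ∧ φ₈ < s₂ ∧ s₂ < φ₉ ∧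
      KaupBoussinesq.equilibria X = {(φ₇, 0), (φ₈, 0), (φ₉, 0)} ∧
      KaupBoussinesq.IsCenter X (φ₇, 0) ∧ KaupBoussinesq.IsSaddle X (φ₈, 0) ∧
      KaupBoussinesq.IsCenter X (φ₉, 0)) := by
  subst hX hf₁ hf₂
  have hdpos : 0 < c ^ 2 + 3 * coeffA g₁ g₂ := by linarith
  have hsqrt := Real.sqrt_pos.2 hdpos
  have hsq := Real.sq_sqrt hdpos.le
  rw [phiStar₁] at hs₁
  rw [phiStar₂] at hs₂
  have hs : s₁ < s₂ := by rw [hs₁, hs₂]; linarith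
  have hsum : 2 * c = 3 * (s₁ + s₂) := by rw [hs₁, hs₂]; ring
  have hprod : coeffA g₁ g₂ = -3 * (s₁ * s₂) := by
    rw [hs₁, hs₂]
    linear_combination -(1 / 3) * hsq
  clear hs₁ hs₂ hsqrt hsq hdpos hΔ
  have hd := cubicDeriv_eq hsum hprod
  have hanti₁ := strictAntiOn_cubic_Iic hs hd
  have hmono := strictMonoOn_cubic_Icc hd
  have hanti₂ := strictAntiOn_cubic_Ici hs hd
  have hs₁m : s₁ ∈ Icc s₁ s₂ := ⟨le_rfl, hs.le⟩
  have hs₂m : s₂ ∈ Icc s₁ s₂ := ⟨hs.le, le_rfl⟩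
  have hf : cubic c g₁ g₂ s₁ < cubic c g₁ g₂ s₂ := hmono hs₁m hs₂m hs
  have hcenter₁ : ∀ φ, φ < s₁ → cubic c g₁ g₂ φ = 0 → IsCenter (field c g₁ g₂) (φ, 0) := by
    intro φ hφ h0
    refine isCenter_field hc hg₂ h0 ?_
    rw [hd]
    nlinarith [mul_pos (sub_pos.2 hφ) (sub_pos.2 (hφ.trans hs))]
  have hcenter₂ : ∀ φ, s₂ < φ → cubic c g₁ g₂ φ = 0 → IsCenter (field c g₁ g₂) (φ, 0) := by
    intro φ hφ h0
    refine isCenter_field hc hg₂ h0 ?_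
    rw [hd]
    nlinarith [mul_pos (sub_pos.2 hφ) (sub_pos.2 (hs.trans hφ))]
  -- `s₂` is the strict maximum point to the right of `s₁`, and `s₁` the strict minimum point to the
  -- left of `s₂`; this excludes further roots when an extremal value is zero or has the wrong sign.
  have hle : ∀ φ, s₁ < φ → φ ≠ s₂ → cubic c g₁ g₂ φ < cubic c g₁ g₂ s₂ := by
    intro φ hφ hne
    rcases hne.lt_or_gt with h | h
    · exact hmono ⟨hφ.le, h.le⟩ hs₂m h
    · exact hanti₂ (mem_Ici.2 le_rfl) (mem_Ici.2 h.le) h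
  have hge : ∀ φ, φ < s₂ → φ ≠ s₁ → cubic c g₁ g₂ s₁ < cubic c g₁ g₂ φ := by
    intro φ hφ hne
    rcases hne.lt_or_gt with h | h
    · exact hanti₁ (mem_Iic.2 h.le) (mem_Iic.2 le_rfl) h
    · exact hmono hs₁m ⟨h.le, hφ.le⟩ h
  refine ⟨fun h => ?_, fun h => ?_, fun h => ?_, fun h => ?_, fun h h' => ?_⟩
  · obtain ⟨φ, hφ, h0⟩ := exists_root_lt hs hsum hd (hf.trans h)
    refine ⟨φ, hφ, hs, ?_, hcenter₁ φ hφ h0⟩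
    rw [equilibria_field hc hg₂ (S := {φ}), image_singleton]
    refine fun x => ⟨fun hx => ?_, fun hx => hx ▸ h0⟩
    rcases le_or_gt x s₁ with hx₁ | hx₁
    · exact hanti₁.injOn hx₁ hφ.le (hx.trans h0.symm)
    · rcases eq_or_ne x s₂ with rfl | hx₂
      · linarith
      · linarith [hle x hx₁ hx₂]
  · obtain ⟨φ, hφ, h0⟩ := exists_root_gt hs hsum hd (h.trans hf)
    refine ⟨φ, hs, hφ, ?_, hcenter₂ φ hφ h0⟩
    rw [equilibria_field hc hg₂ (S := {φ}), image_singleton]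
    refine fun x => ⟨fun hx => ?_, fun hx => hx ▸ h0⟩
    rcases le_or_gt s₂ x with hx₁ | hx₁
    · exact hanti₂.injOn hx₁ hφ.le (hx.trans h0.symm)
    · rcases eq_or_ne x s₁ with rfl | hx₂
      · linarith
      · linarith [hge x hx₁ hx₂]
  · obtain ⟨φ, hφ, h0⟩ := exists_root_gt hs hsum hd (h ▸ hf)
    refine ⟨s₁, φ, rfl, hs, hφ, ?_, isCusp_field hc hg₂ h (by rw [hd]; ring) ?_, hcenter₂ φ hφ h0⟩
    · rw [equilibria_field hc hg₂ (S := {s₁, φ}), image_pair]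
      refine fun x => ⟨fun hx => ?_, ?_⟩
      · rcases le_or_gt s₂ x with hx₁ | hx₁
        · exact Or.inr (hanti₂.injOn hx₁ hφ.le (hx.trans h0.symm))
        · refine Or.inl (by_contra fun hx₂ => ?_)
          linarith [hge x hx₁ hx₂]
      · rintro (rfl | rfl)
        exacts [h, h0]
    -- `c = 3 s₁` together with `2 c = 3 (s₁ + s₂)` would force `s₁ = s₂`: the root is double, not
    -- triple.
    · intro h'
      linarith
  · obtain ⟨φ, hφ, h0⟩ := exists_root_lt hs hsum hd (h ▸ hf)
    refine ⟨φ, s₂, hφ, hs, rfl, ?_, hcenter₁ φ hφ h0, isCusp_field hc hg₂ h (by rw [hd]; ring) ?_⟩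
    · rw [equilibria_field hc hg₂ (S := {φ, s₂}), image_pair]
      refine fun x => ⟨fun hx => ?_, ?_⟩
      · rcases le_or_gt x s₁ with hx₁ | hx₁
        · exact Or.inl (hanti₁.injOn hx₁ hφ.le (hx.trans h0.symm))
        · refine Or.inr (by_contra fun hx₂ => ?_)
          linarith [hle x hx₁ hx₂]
      · rintro (rfl | rfl)
        exacts [h0, h]
    · intro h'
      linarith
  · obtain ⟨φ₇, hφ₇, h₇⟩ := exists_root_lt hs hsum hd h
    obtain ⟨φ₉, hφ₉, h₉⟩ := exists_root_gt hs hsum hd h'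
    obtain ⟨φ₈, ⟨hφ₈, hφ₈'⟩, h₈⟩ := intermediate_value_Ioo hs.le
      (continuous_cubic c g₁ g₂).continuousOn ⟨h, h'⟩
    refine ⟨φ₇, φ₈, φ₉, hφ₇, hφ₈, hφ₈', hφ₉, ?_, hcenter₁ φ₇ hφ₇ h₇,
      isSaddle_field hc hg₂ h₈ ?_, hcenter₂ φ₉ hφ₉ h₉⟩
    · rw [equilibria_field hc hg₂ (S := {φ₇, φ₈, φ₉}), image_insert_eq, image_pair]
      refine fun x => ⟨fun hx => ?_, ?_⟩
      · rcases le_or_gt x s₁ with hx₁ | hx₁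
        · exact Or.inl (hanti₁.injOn hx₁ hφ₇.le (hx.trans h₇.symm))
        · rcases le_or_gt x s₂ with hx₂ | hx₂
          · exact Or.inr (Or.inl
              (hmono.injOn ⟨hx₁.le, hx₂⟩ ⟨hφ₈.le, hφ₈'.le⟩ (hx.trans h₈.symm)))
          · exact Or.inr (Or.inr (hanti₂.injOn hx₂.le hφ₉.le (hx.trans h₉.symm)))
      · rintro (rfl | rfl | rfl)
        exacts [h₇, h₈, h₉]
    · rw [hd]
      nlinarith [mul_pos (sub_pos.2 hφ₈) (sub_pos.2 hφ₈')]
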